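/- Let $\ell\neq 2$ be a prime and $d\ge 1$ an integer with $\ell\nmid d$. Let $X$ be a smooth, proper, geometrically connected curve over a field $k$ of characteristic different from $\ell$, let $\bar k$ be an algebraic closure of $k$, $\bar X=X\times_k\bar k$, and let $\bar x$ be a $\bar k$-point of $X$ over $k$. Write $\pi_1(X)=\pi_1(X,\bar x)$ for the étale fundamental group and $\pi_1(\bar X)=\pi_1(\bar X,\bar x)\subset\pi_1(X)$ for the geometric étale fundamental group, a normal subgroup of $\pi_1(X)$. Let $\mathcal O$ be the ring of integers of a finite extension of $\mathbb Q_\ell$, with maximal ideal $\mathfrak m$ and (finite) residue field $\mathbb F$. Let $\rho_0:\pi_1(X)\to \mathrm{GL}_d(\mathbb F)$ be a continuous representation and $\epsilon:\pi_1(X)\to\mathcal O^\times$ a continuous character with $\epsilon \bmod \mathfrak m=\det\rho_0$. Denote by $\bar\rho_0,\bar\epsilon$ their restrictions to $\pi_1(\bar X)$, and assume that $\bar\rho_0$ is absolutely irreducible. Let $A$ be a complete Noetherian local $\mathcal O$-algebra with maximal ideal $\mathfrak m_A$, with its $\mathfrak m_A$-adic topology, together with an isomorphism of $\mathcal O$-algebras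 $\alpha:A/\mathfrak m_A\cong\mathbb F$; reduction modulo $\mathfrak m_A$ is always followed by $\alpha$. Let $\bar\rho:\pi_1(\bar X)\to\mathrm{GL}_d(A)$ be a continuous representation which reduces to $\bar\rho_0$ modulo $\mathfrak m_A$ and whose determinant is $\bar\epsilon$ (composed with $\mathcal O^\times\to A^\times$). Suppose that for every $g\in\pi_1(X)$ there is $h_g\in\mathrm{GL}_d(A)$ with $$\bar\rho(g\gamma g^{-1})=h_g\,\bar\rho(\gamma)\,h_g^{-1}\qquad\text{for all }\gamma\in\pi_1(\bar X).$$ Then the class of $h_g$ in $\mathrm{PGL}_d(A)=\mathrm{GL}_d(A)/A^\times$ does not depend on the choice of $h_g$, and $g\mapsto h_g \bmod A^\times$ is a homomorphism $\rho_{\mathrm{PGL}}:\pi_1(X)\to\mathrm{PGL}_d(A)$ extending the composition of $\bar\rho$ with $\mathrm{GL}_d(A)\to\mathrm{PGL}_d(A)$. Moreover, there is a continuous representation $\rho:\pi_1(X)\to\mathrm{GL}_d(A)$ which lifts $\rho_{\mathrm{PGL}}$ and satisfies $\det\rho=\epsilon$ (composed with $\mathcal O^\times\to A^\times$), $\rho|_{\pi_1(\bar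 X)}=\bar\rho$, and $\rho\bmod\mathfrak m_A=\rho_0$. -/

import Mathlib

open CategoryTheory AlgebraicGeometry Limits IsLocalRing
open scoped MatrixGroups

universe u v w

noncomputable section

/-! ### Étale fundamental groups -/

namespace EtalePi

/-- The property of a morphism of schemes of being finite étale. -/
abbrev finiteEtale : MorphismProperty Scheme.{u} := @IsFinite ⊓ @Etale

instance : finiteEtale.{u}.IsStableUnderBaseChange :=
  MorphismProperty.IsStableUnderBaseChange.inf

/-- The category of finite étale coverings of a scheme `S`. -/
abbrev FEt (S : Scheme.{u}) : Type (u + 1) := MorphismProperty.Over finiteEtale ⊤ S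

variable {Ω : Type u} [Field Ω]

/-- The fibre of an `S`-scheme `p : Y ⟶ S` over a geometric point `s` of `S`: the set of
`Ω`-points of `Y` lying over `s`. -/
abbrev FibreSet {Y S : Scheme.{u}} (p : Y ⟶ S) (s : Spec (.of Ω) ⟶ S) : Type u :=
  {y : Spec (.of Ω) ⟶ Y // y ≫ p = s}

/-- The geometric fibre of a base change is the geometric fibre of the original scheme. -/
def fibrePullbackEquiv {Y S T : Scheme.{u}} (p : Y ⟶ S) (f : T ⟶ S)
    {t : Spec (.of Ω) ⟶ T} {s : Spec (.of Ω) ⟶ S} (h : t ≫ f = s) :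
    FibreSet (pullback.snd p f) t ≃ FibreSet p s where
  toFun y := ⟨y.1 ≫ pullback.fst p f, by
    rw [Category.assoc, pullback.condition, ← Category.assoc, y.2, h]⟩
  invFun y := ⟨pullback.lift y.1 t (by rw [y.2, h]), pullback.lift_snd _ _ _⟩
  left_inv y := by
    apply Subtype.ext
    apply pullback.hom_ext
    · exact pullback.lift_fst _ _ _
    · exact (pullback.lift_snd _ _ _).trans y.2.symm
  right_inv _ := Subtype.ext (pullback.lift_fst _ _ _)

theorem finite_fibreSet [IsAlgClosed Ω] {Y S : Scheme.{u}} (p : Y ⟶ S) [IsFinite p]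
    (s : Spec (.of Ω) ⟶ S) : Finite (FibreSet p s) := by
  have e := fibrePullbackEquiv p s (t := 𝟙 _) (Category.id_comp s)
  have hfin : Finite (pullback p s : Scheme.{u}) := by
    have h := Scheme.Hom.finite_preimage_singleton (pullback.snd p s) (closedPoint Ω)
    refine Set.finite_univ_iff.mp (h.subset fun x _ => ?_)
    exact Set.mem_preimage.mpr (Subsingleton.elim (α := PrimeSpectrum Ω) _ _)
  have : Finite (FibreSet (pullback.snd p s) (𝟙 _)) := by
    refine Finite.of_injective
      (fun y : FibreSet (pullback.snd p s) (𝟙 _) => y.1 (closedPoint Ω)) ?_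
    intro y z hyz
    exact Subtype.ext (ext_of_apply_closedPoint_eq (pullback.snd p s) y.2 z.2 hyz)
  exact Finite.of_equiv _ e

variable [IsAlgClosed Ω]

instance {S : Scheme.{u}} (Y : FEt S) (s : Spec (.of Ω) ⟶ S) : Finite (FibreSet Y.hom s) :=
  have : IsFinite Y.hom := Y.prop.1
  finite_fibreSet Y.hom s

/-- The fibre functor of finite étale coverings at a geometric point. -/
def fibre (S : Scheme.{u}) (s : Spec (.of Ω) ⟶ S) : FEt S ⥤ FintypeCat.{u} where
  obj Y := FintypeCat.of (FibreSet Y.hom s)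
  map {Y Z} g := FintypeCat.homMk fun y => ⟨y.1 ≫ g.left, by
    rw [Category.assoc, MorphismProperty.Over.w g, y.2]⟩

/-- The étale fundamental group of `S` at the geometric point `s`: the automorphism group of the
fibre functor, with its profinite topology. -/
abbrev PiOne (S : Scheme.{u}) (s : Spec (.of Ω) ⟶ S) : Type (u + 1) := Aut (fibre S s)

/-- Base change along `f` is compatible with fibre functors. -/
def pullbackFibreIso {S T : Scheme.{u}} (f : T ⟶ S)
    {t : Spec (.of Ω) ⟶ T} {s : Spec (.of Ω) ⟶ S} (h : t ≫ f = s) :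
    MorphismProperty.Over.pullback finiteEtale ⊤ f ⋙ fibre T t ≅ fibre S s :=
  NatIso.ofComponents
    (fun Y => FintypeCat.equivEquivIso (fibrePullbackEquiv Y.hom f h))
    (fun {Y Z} g => by
      ext y
      exact Subtype.ext <| (Category.assoc _ _ _).trans <|
        (congrArg (y.1 ≫ ·) (pullback.lift_fst _ _ _)).trans (Category.assoc _ _ _).symm)

/-- The homomorphism of étale fundamental groups induced by a morphism `f : (T, t) ⟶ (S, s)`
of pointed schemes: an automorphism of the fibre functor of `T` acts on the fibre of a covering
`Y` of `S` through the identification of this fibre with the fibre of `Y ×[S] T`. -/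
def piOneMap {S T : Scheme.{u}} (f : T ⟶ S)
    {t : Spec (.of Ω) ⟶ T} {s : Spec (.of Ω) ⟶ S} (h : t ≫ f = s) :
    PiOne T t →* PiOne S s :=
  (Iso.conjAut (pullbackFibreIso f h)).toMonoidHom.comp
    (((Functor.whiskeringLeft _ _ FintypeCat.{u}).obj
      (MorphismProperty.Over.pullback finiteEtale ⊤ f)).mapAut (fibre T t))

/-- The base change `X ×ₖ k̄` of a `k`-scheme `X`. -/
abbrev geomBaseChange {k : Type u} [Field k] (kbar : Type u) [Field kbar] [Algebra k kbar]
    {X : Scheme.{u}} (f : X ⟶ Spec (.of k)) : Scheme.{u} :=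
  pullback f (Spec.map (CommRingCat.ofHom (algebraMap k kbar)))

section

variable {k kbar : Type u} [Field k] [Field kbar] [Algebra k kbar] {X : Scheme.{u}}
  (f : X ⟶ Spec (.of k)) (x : Spec (.of kbar) ⟶ X)
  (hx : x ≫ f = Spec.map (CommRingCat.ofHom (algebraMap k kbar)))

/-- The `k̄`-point of `X ×ₖ k̄` defined by a `k̄`-point of the `k`-scheme `X`. -/
abbrev geomBasePoint : Spec (.of kbar) ⟶ geomBaseChange kbar f :=
  pullback.lift x (𝟙 _) (by rw [hx, Category.id_comp])

/-- The geometric étale fundamental group `π₁(X̄, x̄)`, `X̄ = X ×ₖ k̄`, as a subgroup of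
`π₁(X, x̄)`: the image of the homomorphism induced by the projection `X̄ ⟶ X`. It carries the
subspace topology. -/
def geomPiOne [IsAlgClosed kbar] : Subgroup (PiOne X x) :=
  (piOneMap (pullback.fst f (Spec.map (CommRingCat.ofHom (algebraMap k kbar))))
    (t := geomBasePoint f x hx) (pullback.lift_fst _ _ _)).range

end

end EtalePi

/-! ### Rings of integers of `ℓ`-adic fields -/

namespace EllAdic

theorem isIntegral_iff_spectralNorm_le_one (ℓ : ℕ) [Fact ℓ.Prime] (E : Type w) [Field E]
    [Algebra ℚ_[ℓ] E] [FiniteDimensional ℚ_[ℓ] E] [Algebra ℤ_[ℓ] E]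
    [IsScalarTower ℤ_[ℓ] ℚ_[ℓ] E] (x : E) :
    IsIntegral ℤ_[ℓ] x ↔ spectralNorm ℚ_[ℓ] E x ≤ 1 := by
  have hx : IsIntegral ℚ_[ℓ] x := Algebra.IsIntegral.isIntegral x
  rw [spectralNorm, spectralValue_le_one_iff (minpoly.monic hx)]
  constructor
  · intro h n
    rw [minpoly.isIntegrallyClosed_eq_field_fractions' ℚ_[ℓ] h, Polynomial.coeff_map]
    exact PadicInt.norm_le_one _
  · intro h
    have hl : minpoly ℚ_[ℓ] x ∈ Polynomial.lifts (algebraMap ℤ_[ℓ] ℚ_[ℓ]) := by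
      rw [Polynomial.lifts_iff_coeff_lifts]
      exact fun n => ⟨⟨_, h n⟩, rfl⟩
    obtain ⟨q, hq, -, hm⟩ :=
      Polynomial.lifts_and_natDegree_eq_and_monic hl (minpoly.monic hx)
    refine ⟨q, hm, ?_⟩
    have := minpoly.aeval ℚ_[ℓ] x
    rwa [← hq, Polynomial.aeval_map_algebraMap] at this

/-- The ring of integers of a finite extension of `ℚ_ℓ` is local. -/
instance isLocalRing_integralClosure (ℓ : ℕ) [Fact ℓ.Prime] (E : Type w) [Field E]
    [Algebra ℚ_[ℓ] E] [FiniteDimensional ℚ_[ℓ] E] [Algebra ℤ_[ℓ] E]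
    [IsScalarTower ℤ_[ℓ] ℚ_[ℓ] E] : IsLocalRing (integralClosure ℤ_[ℓ] E) := by
  have hunit : ∀ x : integralClosure ℤ_[ℓ] E, 1 ≤ spectralNorm ℚ_[ℓ] E x.1 → IsUnit x := by
    intro x hx
    have hx0 : x.1 ≠ 0 := by
      intro h
      rw [h, spectralNorm_zero] at hx
      exact absurd hx (by norm_num)
    have hmul : spectralNorm ℚ_[ℓ] E x.1 * spectralNorm ℚ_[ℓ] E x.1⁻¹ = 1 := by
      have h := spectralAlgNorm_mul (K := ℚ_[ℓ]) x.1 x.1⁻¹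
      rw [mul_inv_cancel₀ hx0, spectralAlgNorm_one] at h
      exact h.symm
    have hinv : x.1⁻¹ ∈ integralClosure ℤ_[ℓ] E := by
      refine (isIntegral_iff_spectralNorm_le_one ℓ E _).mpr ?_
      nlinarith [spectralNorm_nonneg (K := ℚ_[ℓ]) x.1⁻¹]
    exact IsUnit.of_mul_eq_one ⟨_, hinv⟩ (Subtype.ext (mul_inv_cancel₀ hx0))
  refine IsLocalRing.of_isUnit_or_isUnit_one_sub_self fun x => ?_
  have h := isNonarchimedean_spectralNorm (K := ℚ_[ℓ]) (L := E) x.1 (1 - x.1)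
  rw [add_sub_cancel, spectralNorm_one, le_max_iff] at h
  exact h.imp (hunit x) (hunit (1 - x))

end EllAdic

/-! ### Representations -/

namespace GaloisLift

open Matrix

/-- The representation over an algebraic closure of `F` attached to `r : G → GL_d(F)`. -/
def geomRep {G : Type v} [Group G] {F : Type w} [Field F] {d : ℕ} (r : G →* GL (Fin d) F) :
    Representation (AlgebraicClosure F) G (Fin d → AlgebraicClosure F) :=
  ((Matrix.toLinAlgEquiv' : Matrix (Fin d) (Fin d) (AlgebraicClosure F) ≃ₐ[AlgebraicClosure F]
      ((Fin d → AlgebraicClosure F) →ₗ[AlgebraicClosure F]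
        (Fin d → AlgebraicClosure F))) : _ →* _).comp
    ((Units.coeHom _).comp
      ((GeneralLinearGroup.map (algebraMap F (AlgebraicClosure F))).comp r))

/-- Absolute irreducibility: irreducibility over an algebraic closure. -/
def IsAbsolutelyIrreducible {G : Type v} [Group G] {F : Type w} [Field F] {d : ℕ}
    (r : G →* GL (Fin d) F) : Prop :=
  (geomRep r).IsIrreducible

/-- The reduction map `GL_d(A) → GL_d(A/𝔪_A) ≅ GL_d(F)` for a local ring `A` with a given
identification `α` of its residue field with `F`. -/
def reduction {O : Type v} [CommRing O] {A F : Type*} [CommRing A] [IsLocalRing A] [CommRing F]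
    [Algebra O A] [Algebra O F] (d : ℕ) (α : ResidueField A ≃ₐ[O] F) :
    GL (Fin d) A →* GL (Fin d) F :=
  GeneralLinearGroup.map ((α : ResidueField A →+* F).comp (residue A))

/-- `h ∈ GL_d(A)` intertwines the representation `r` of the subgroup `Γ` with its conjugate by `g`:
for all `γ ∈ Γ` one has `r (g γ g⁻¹) = h r(γ) h⁻¹` (which includes `g γ g⁻¹ ∈ Γ`). -/
def ConjugateBy {G : Type v} [Group G] (Γ : Subgroup G) {A : Type w} [CommRing A] {d : ℕ}
    (r : Γ →* GL (Fin d) A) (g : G) (h : GL (Fin d) A) : Prop :=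
  ∀ γ : Γ, ∃ hγ : g * γ * g⁻¹ ∈ Γ, r ⟨g * γ * g⁻¹, hγ⟩ = h * r γ * h⁻¹

end GaloisLift

end

/-! Write `Γ` for the geometric subgroup of `G = π₁(X)`. Two conjugators `h_g` for the same `g`
differ by an element of the centralizer of the image of `ρbar`. Schur's lemma makes the residual
centralizer scalar, and a Nakayama-type argument lifts this to `A`, and modulo any ideal `J`
(`exists_scalar_of_commute_mod`). So `h_g` is well defined up to scalars.

Two rescalings normalize `h_g`: a unit of `A` makes it reduce to `ρ₀ g`, then a `d`-th root of a
principal unit, supplied by Hensel since `d` is invertible, gives it determinant `ε g`. The result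
is unique, because a principal unit `c` with `c ^ d = 1` is `1`. Uniqueness makes `g ↦ h_g`
multiplicative and equal to `ρbar` on `Γ`, where `ρbar γ` is itself normalized. The projective
representation is the class of this `ρ`.

Continuity is the same rigidity modulo `𝔪_A ^ n`. For `u` in a small open normal subgroup, each
commutator `u γ u⁻¹ γ⁻¹` lies in `Γ` close to `1`, so `ρ u` commutes with `ρbar` modulo `𝔪_A ^ n`.
As `ρ₀ u = 1` and `ε u ≡ 1` near the identity, `ρ u ≡ 1`. -/

namespace GaloisLift

open Matrix

/-! ### Schur's lemma over a field that need not be algebraically closed -/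

section Schur

variable {G : Type*} [Group G] {d : ℕ}

/-- **Schur's lemma** for an absolutely irreducible matrix representation. -/
theorem IsAbsolutelyIrreducible.exists_eq_scalar {F : Type*} [Field F]
    {r : G →* GL (Fin d) F} (hr : IsAbsolutelyIrreducible r) (N : Matrix (Fin d) (Fin d) F)
    (hN : ∀ g, (r g : Matrix (Fin d) (Fin d) F) * N = N * r g) :
    ∃ c : F, N = scalar (Fin d) c := by
  rcases Nat.eq_zero_or_pos d with rfl | hd
  · exact ⟨0, Subsingleton.elim _ _⟩
  have : (geomRep r).IsIrreducible := hr
  let K := AlgebraicClosure F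
  let N' : Matrix (Fin d) (Fin d) K := N.map (algebraMap F K)
  let T : Representation.IntertwiningMap (geomRep r) (geomRep r) :=
    LinearMap.intertwiningMap_of_isIntertwiningMap _ _ (Matrix.toLin' N') (by
      intro g v
      have h : (N' * (r g : Matrix (Fin d) (Fin d) F).map (algebraMap F K)) =
          (r g : Matrix (Fin d) (Fin d) F).map (algebraMap F K) * N' := by
        rw [← Matrix.map_mul, ← Matrix.map_mul, hN]
      change N' *ᵥ ((r g : Matrix (Fin d) (Fin d) F).map (algebraMap F K) *ᵥ v) =
        (r g : Matrix (Fin d) (Fin d) F).map (algebraMap F K) *ᵥ (N' *ᵥ v)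
      rw [mulVec_mulVec, mulVec_mulVec, h])
  obtain ⟨c, hc⟩ :=
    (Representation.IsIrreducible.algebraMap_intertwiningMap_bijective_of_isAlgClosed
      (ρ := geomRep r)).2 T
  have hT : N' = scalar (Fin d) c := by
    apply Matrix.toLin'.injective
    ext i : 1
    have := congrArg (fun S : Representation.IntertwiningMap (geomRep r) (geomRep r) =>
      S.toLinearMap (Pi.single i 1)) hc
    ext j
    have := congrFun this j
    simp only [LinearMap.coe_comp, Function.comp_apply, LinearMap.coe_single]
    refine this.symm.trans ?_
    change c • (Pi.single i (1 : K) : Fin d → K) j = _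
    simp [scalar_apply, Pi.single_apply]
  -- The scalar `c` lives in the algebraic closure; being the corner entry of `N'`, it comes from
  -- `F`.
  refine ⟨N ⟨0, hd⟩ ⟨0, hd⟩, ?_⟩
  have h0 : c = algebraMap F K (N ⟨0, hd⟩ ⟨0, hd⟩) := by
    have := congrFun (congrFun hT ⟨0, hd⟩) ⟨0, hd⟩
    simpa [N'] using this.symm
  ext i j
  apply (algebraMap F K).injective
  have := congrFun (congrFun hT i) j
  rw [h0] at this
  refine this.trans ?_
  rcases eq_or_ne i j with rfl | hij
  · simp
  · simp [hij]

end Schur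

/-! ### Centralizers and `d`-th roots over a local ring -/

section Local

variable {d : ℕ} {A : Type*} [CommRing A] [IsLocalRing A] {F : Type*} [Field F]

/-- A nonzero finitely generated module over a local ring surjects onto the residue field. -/
theorem exists_linearMap_residueField_surjective (P : Type*) [AddCommGroup P] [Module A P]
    [Module.Finite A P] [Nontrivial P] :
    ∃ f : P →ₗ[A] ResidueField A, Function.Surjective f := by
  obtain ⟨Q, hQ⟩ := IsCoatomic.exists_coatom (α := Submodule A P)
  have : IsSimpleModule A (P ⧸ Q) := isSimpleModule_iff_isCoatom.mpr hQ
  obtain ⟨I, hI, ⟨e⟩⟩ := isSimpleModule_iff_quot_maximal.mp this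
  obtain rfl := IsLocalRing.eq_maximalIdeal hI
  exact ⟨e.toLinearMap ∘ₗ Q.mkQ, e.surjective.comp Q.mkQ_surjective⟩

/-- Let `S` be a set of matrices over a Noetherian local ring whose residual centralizer consists
of scalar matrices. A matrix commuting with `S` modulo an ideal `J` is scalar modulo `J`. -/
theorem exists_scalar_of_commute_mod [IsNoetherianRing A]
    {S : Set (Matrix (Fin d) (Fin d) A)}
    (hS : ∀ N : Matrix (Fin d) (Fin d) (ResidueField A),
      (∀ s ∈ S, s.map (residue A) * N = N * s.map (residue A)) →
        ∃ c, N = scalar (Fin d) c)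
    (J : Ideal A) (H : Matrix (Fin d) (Fin d) A)
    (hH : ∀ s ∈ S, ∀ i j, (s * H - H * s) i j ∈ J) :
    ∃ c : A, ∀ i j, (H - scalar (Fin d) c) i j ∈ J := by
  rcases Nat.eq_zero_or_pos d with rfl | hd
  · exact ⟨0, fun i => i.elim0⟩
  let o : Fin d := ⟨0, hd⟩
  refine ⟨H o o, ?_⟩
  set H' := H - scalar (Fin d) (H o o) with hH'
  have hcomm : ∀ s ∈ S, ∀ i j, (s * H' - H' * s) i j ∈ J := by
    intro s hs i j
    have : s * H' - H' * s = s * H - H * s := by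
      have := (scalar_commute (H o o) (fun r => mul_comm _ r) s).eq
      rw [hH', mul_sub, sub_mul, this]; abel
    rw [this]; exact hH s hs i j
  have h00 : H' o o = 0 := by simp [hH']
  -- After subtracting the corner scalar, it remains to see that the entries of `H'` generate the
  -- zero submodule `P` of `A ⧸ J`. Otherwise a surjection from `P` to the residue field, applied
  -- entrywise, gives a residual matrix `N` commuting with `S`. It is scalar with zero corner, hence
  -- zero, so the surjection kills the generators of `P`.
  let P : Submodule A (A ⧸ J) := Submodule.span A
    (Set.range fun p : Fin d × Fin d => Submodule.Quotient.mk (p := J) (H' p.1 p.2))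
  let n : Fin d → Fin d → P := fun i j =>
    ⟨Submodule.Quotient.mk (H' i j), Submodule.subset_span ⟨(i, j), rfl⟩⟩
  suffices hP : P = ⊥ by
    intro i j
    have : Submodule.Quotient.mk (p := J) (H' i j) ∈ P := (n i j).2
    rw [hP, Submodule.mem_bot] at this
    exact (Submodule.Quotient.mk_eq_zero J).mp this
  by_contra hP
  have : Nontrivial P := Submodule.nontrivial_iff_ne_bot.mpr hP
  obtain ⟨f, hf⟩ := exists_linearMap_residueField_surjective (A := A) P
  have hsmul : ∀ (a : A) (y : ResidueField A), a • y = residue A a * y := fun a y =>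
    Algebra.smul_def a y
  let N : Matrix (Fin d) (Fin d) (ResidueField A) := Matrix.of fun i j => f (n i j)
  obtain ⟨c, hc⟩ := hS N (by
    intro s hs
    ext i j
    have key : ∑ k, s i k • n k j = ∑ k, s k j • n i k := by
      apply Subtype.ext
      have h := (Submodule.Quotient.mk_eq_zero J).mpr (hcomm s hs i j)
      rw [Matrix.sub_apply, Submodule.Quotient.mk_sub, sub_eq_zero] at h
      simp only [Matrix.mul_apply] at h
      have e1 : ∀ t : Fin d → A, (Submodule.Quotient.mk (p := J) (∑ k, t k)) =
          ∑ k, Submodule.Quotient.mk (p := J) (t k) := fun t => map_sum J.mkQ t _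
      rw [e1, e1] at h
      simp only [AddSubmonoidClass.coe_finsetSum, Submodule.coe_smul, n]
      simp only [← Submodule.Quotient.mk_smul, smul_eq_mul]
      rw [h]
      exact Finset.sum_congr rfl fun k _ => by rw [mul_comm]
    have := congrArg f key
    simp only [map_sum, map_smul, hsmul] at this
    simp only [Matrix.mul_apply, Matrix.map_apply, N, Matrix.of_apply]
    rw [this]
    exact Finset.sum_congr rfl fun k _ => mul_comm _ _)
  have hc0 : c = 0 := by
    have h := congrFun (congrFun hc o) o
    have hn : n o o = 0 := Subtype.ext (by simp [n, h00])
    simpa [N, hn] using h.symm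
  have hf0 : f = 0 := by
    have hker : ∀ i j, f (n i j) = 0 := fun i j => by
      have := congrFun (congrFun hc i) j
      simpa [N, hc0] using this
    ext ⟨y, hy⟩
    induction hy using Submodule.span_induction with
    | mem y hy => obtain ⟨p, rfl⟩ := hy; exact hker p.1 p.2
    | zero => exact map_zero f
    | add a b ha hb iha ihb =>
      exact (map_add f ⟨a, ha⟩ ⟨b, hb⟩).trans ((congrArg₂ (· + ·) iha ihb).trans (add_zero 0))
    | smul t a ha iha => exact (map_smul f t ⟨a, ha⟩).trans ((congrArg (t • ·) iha).trans (smul_zero t))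
  obtain ⟨y, hy⟩ := hf 1
  rw [hf0] at hy
  exact zero_ne_one hy

/-- In a local ring in which `d` is invertible, an element which is `1` in the residue field and
whose `d`-th power is `1` modulo `J` is `1` modulo `J`. -/
theorem sub_one_mem_of_pow_sub_one_mem (hd : IsUnit (d : A)) {J : Ideal A} {c : A}
    (hc : residue A c = 1) (h : c ^ d - 1 ∈ J) : c - 1 ∈ J := by
  -- The cofactor of `c - 1` in `c ^ d - 1` reduces to `d`, hence is a unit.
  have hu : IsUnit (∑ i ∈ Finset.range d, c ^ i) := by
    rw [← isUnit_map_iff (residue A)]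
    simpa [hc] using hd.map (residue A)
  rw [← geom_sum_mul] at h
  exact (Ideal.unit_mul_mem_iff_mem J hu).mp h

/-- A matrix commuting modulo `J` with a set of matrices with scalar residual centralizer, and
which is residually trivial with determinant `1` modulo `J`, is trivial modulo `J`. -/
theorem sub_one_mem_of_commute_mod [IsNoetherianRing A] (hd : IsUnit (d : A))
    {S : Set (Matrix (Fin d) (Fin d) A)}
    (hS : ∀ N : Matrix (Fin d) (Fin d) (ResidueField A),
      (∀ s ∈ S, s.map (residue A) * N = N * s.map (residue A)) →
        ∃ c, N = scalar (Fin d) c)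
    {J : Ideal A} (hJ : J ≤ maximalIdeal A) {H : Matrix (Fin d) (Fin d) A}
    (hH : ∀ s ∈ S, ∀ i j, (s * H - H * s) i j ∈ J)
    (hres : H.map (residue A) = 1) (hdet : H.det - 1 ∈ J) :
    ∀ i j, (H - 1) i j ∈ J := by
  obtain ⟨c, hc⟩ := exists_scalar_of_commute_mod hS J H hH
  have hmap : H.map (Ideal.Quotient.mk J) = scalar (Fin d) (Ideal.Quotient.mk J c) := by
    ext i j
    have := Ideal.Quotient.eq.mpr (show H i j - scalar (Fin d) c i j ∈ J from hc i j)
    rw [Matrix.map_apply, this]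
    rcases eq_or_ne i j with rfl | hij <;> simp [*]
  -- Modulo `J` the determinant of `H` is that of the scalar matrix `c`.
  have hpow : c ^ d - 1 ∈ J := by
    rw [← Ideal.Quotient.eq] at hdet ⊢
    rw [← hdet, RingHom.map_det, RingHom.mapMatrix_apply, hmap]
    simp
  intro i j
  have hc1 : residue A c = 1 := by
    have h := (residue_eq_zero_iff _).mpr (hJ (hc i i))
    have h1 := congrFun (congrFun hres i) i
    simp only [Matrix.map_apply, Matrix.one_apply_eq] at h1
    simp only [Matrix.sub_apply, scalar_apply, diagonal_apply_eq, map_sub, h1] at h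
    exact (sub_eq_zero.mp h).symm
  have hcJ := sub_one_mem_of_pow_sub_one_mem hd hc1 hpow
  have e : (H - 1) i j = (H - scalar (Fin d) c) i j + (scalar (Fin d) (c - 1)) i j := by
    rw [← Matrix.add_apply, map_sub, map_one]; simp
  rw [e]
  refine J.add_mem (hc i j) ?_
  rcases eq_or_ne i j with rfl | hij <;> simp [*]

/-- Hensel's lemma for `d`-th roots of principal units. -/
theorem exists_pow_eq_of_residue_eq_one [IsAdicComplete (maximalIdeal A) A]
    (hd : IsUnit (d : A)) {a : A} (ha : residue A a = 1) :
    ∃ b : A, b ^ d = a ∧ residue A b = 1 := by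
  have hd0 : d ≠ 0 := by
    rintro rfl
    simp at hd
  have hmem : 1 - a ∈ maximalIdeal A := by
    rw [← residue_eq_zero_iff]; simp [ha]
  -- `1` is an approximate root of `X ^ d - a`, and it is simple since the derivative there is `d`.
  obtain ⟨b, hb, hb1⟩ := HenselianRing.is_henselian (I := maximalIdeal A)
    (Polynomial.X ^ d - Polynomial.C a) (Polynomial.monic_X_pow_sub_C a hd0) 1
    (by simpa using hmem) (by simpa [Polynomial.derivative_X_pow] using hd.map (Ideal.Quotient.mk (maximalIdeal A)))
  refine ⟨b, ?_, ?_⟩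
  · simpa [Polynomial.IsRoot, sub_eq_zero] using hb
  · have := (residue_eq_zero_iff _).mpr hb1
    rwa [map_sub, map_one, sub_eq_zero] at this

end Local

/-! ### Continuity from congruences at the identity -/

section Continuity

variable {G : Type*} [Group G] {d : ℕ} {A : Type*} [CommRing A]

/-- If the values of a homomorphism into `GL_d(A)` are trivial modulo each power of the ideal of
definition on a neighbourhood of the identity, then it is continuous. -/
theorem continuous_of_eventually_sub_one_mem [TopologicalSpace G] [IsTopologicalGroup G]
    [TopologicalSpace A] {I : Ideal A} (hA : IsAdic I) (ρ : G →* GL (Fin d) A)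
    (h : ∀ n : ℕ, ∀ᶠ u in nhds (1 : G), ∀ i j, ((ρ u : Matrix (Fin d) (Fin d) A) - 1) i j ∈ I ^ n) :
    Continuous ρ := by
  have hval : Continuous fun g => (ρ g : Matrix (Fin d) (Fin d) A) := by
    refine continuous_matrix fun i j => continuous_iff_continuousAt.mpr fun g => ?_
    subst hA
    let _ := I.adicTopology
    refine ((I.hasBasis_nhds_adic _).tendsto_right_iff).mpr fun n _ => ?_
    have htend : Filter.Tendsto (fun y => g⁻¹ * y) (nhds g) (nhds 1) := by
      simpa using (continuous_const_mul g⁻¹).tendsto g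
    filter_upwards [htend.eventually (h n)] with y hy
    refine ⟨(ρ y : Matrix (Fin d) (Fin d) A) i j - (ρ g : Matrix (Fin d) (Fin d) A) i j, ?_, by simp⟩
    have e : (ρ y : Matrix (Fin d) (Fin d) A) - ρ g =
        ρ g * ((ρ (g⁻¹ * y) : Matrix (Fin d) (Fin d) A) - 1) := by
      rw [mul_sub, mul_one, ← Units.val_mul, ← map_mul, mul_inv_cancel_left]
    rw [← Matrix.sub_apply, e, Matrix.mul_apply]
    exact Ideal.sum_mem _ fun k _ => Ideal.mul_mem_left _ _ (hy k j)
  -- The unit topology also asks for continuity of the inverse, which is `ρ` evaluated at `g⁻¹`.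
  refine Units.continuous_iff.mpr ⟨hval, ?_⟩
  have : (fun g => ((ρ g)⁻¹ : GL (Fin d) A).val) = fun g => (ρ g⁻¹).val := by
    funext g
    rw [map_inv]
  rw [this]
  exact hval.comp continuous_inv

end Continuity

/-! ### Calculus of conjugating matrices -/

section Conjugators

variable {G : Type*} [Group G] {Γ : Subgroup G} {d : ℕ} {A : Type*} [CommRing A]
  {r : Γ →* GL (Fin d) A}

theorem ConjugateBy.mul {g g' : G} {h h' : GL (Fin d) A} (H : ConjugateBy Γ r g h)
    (H' : ConjugateBy Γ r g' h') : ConjugateBy Γ r (g * g') (h * h') := by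
  intro γ
  obtain ⟨m', e'⟩ := H' γ
  obtain ⟨m, e⟩ := H ⟨_, m'⟩
  have hg : g * g' * γ * (g * g')⁻¹ = g * (g' * γ * g'⁻¹) * g⁻¹ := by group
  refine ⟨hg ▸ m, ?_⟩
  have : (⟨g * g' * γ * (g * g')⁻¹, hg ▸ m⟩ : Γ) = ⟨g * (g' * γ * g'⁻¹) * g⁻¹, m⟩ :=
    Subtype.ext hg
  rw [this, e, e']
  group

theorem conjugateBy_coe (γ : Γ) : ConjugateBy Γ r (γ : G) (r γ) := fun γ' =>
  ⟨(γ * γ' * γ⁻¹).2, by rw [← map_inv, ← map_mul, ← map_mul]; rfl⟩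

theorem ConjugateBy.mul_of_commute {g : G} {h z : GL (Fin d) A} (H : ConjugateBy Γ r g h)
    (hz : ∀ γ, Commute z (r γ)) : ConjugateBy Γ r g (h * z) := by
  intro γ
  obtain ⟨m, e⟩ := H γ
  refine ⟨m, e.trans ?_⟩
  have := (hz γ).eq
  rw [mul_assoc h z, this]
  group

/-- Source of every uniqueness statement: it puts the ambiguity of a conjugator in the centralizer,
where the scalar criterion applies. -/
theorem ConjugateBy.commute {g : G} {h h' : GL (Fin d) A} (H : ConjugateBy Γ r g h)
    (H' : ConjugateBy Γ r g h') (γ : Γ) : Commute (h⁻¹ * h') (r γ) := by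
  obtain ⟨m, e⟩ := H γ
  obtain ⟨m', e'⟩ := H' γ
  have : h * r γ * h⁻¹ = h' * r γ * h'⁻¹ := e.symm.trans e'
  calc h⁻¹ * h' * r γ = h⁻¹ * (h' * r γ * h'⁻¹) * h' := by group
    _ = h⁻¹ * (h * r γ * h⁻¹) * h' := by rw [this]
    _ = r γ * (h⁻¹ * h') := by group

end Conjugators

/-! ### Normalized conjugators and the extension -/

section Lift

variable {G : Type*} [Group G] (Γ : Subgroup G) {d : ℕ} {A : Type*} [CommRing A] [IsLocalRing A]
  (r : Γ →* GL (Fin d) A) (ρ₀ : G →* GL (Fin d) (ResidueField A)) (δ : G →* Aˣ)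

/-- The matrix `h` intertwines `r` with its conjugate by `g`, reduces to `ρ₀ g` and has
determinant `δ g`. -/
structure NormalizedConjugateBy (g : G) (h : GL (Fin d) A) : Prop where
  conj : ConjugateBy Γ r g h
  red : GeneralLinearGroup.map (residue A) h = ρ₀ g
  det : GeneralLinearGroup.det h = δ g

variable {Γ r ρ₀ δ}

theorem NormalizedConjugateBy.mul {g g' : G} {h h' : GL (Fin d) A}
    (H : NormalizedConjugateBy Γ r ρ₀ δ g h) (H' : NormalizedConjugateBy Γ r ρ₀ δ g' h') :
    NormalizedConjugateBy Γ r ρ₀ δ (g * g') (h * h') where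
  conj := H.conj.mul H'.conj
  red := by rw [map_mul, map_mul, H.red, H'.red]
  det := by rw [map_mul, map_mul, H.det, H'.det]

theorem centralizer_residue
    (hred : (GeneralLinearGroup.map (residue A)).comp r = ρ₀.comp Γ.subtype)
    (hcent : ∀ N : Matrix (Fin d) (Fin d) (ResidueField A),
      (∀ γ : Γ, (ρ₀ γ : Matrix (Fin d) (Fin d) (ResidueField A)) * N = N * ρ₀ γ) →
        ∃ c, N = scalar (Fin d) c)
    (N : Matrix (Fin d) (Fin d) (ResidueField A))
    (hN : ∀ s ∈ Set.range fun γ => (r γ : Matrix (Fin d) (Fin d) A),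
      s.map (residue A) * N = N * s.map (residue A)) :
    ∃ c, N = scalar (Fin d) c := by
  refine hcent N fun γ => ?_
  have h : (ρ₀ γ : Matrix (Fin d) (Fin d) (ResidueField A)) =
      (r γ : Matrix (Fin d) (Fin d) A).map (residue A) :=
    (congrArg Units.val (DFunLike.congr_fun hred γ)).symm
  rw [h]
  exact hN _ ⟨γ, rfl⟩

/-- The case `J = ⊥` of `exists_scalar_of_commute_mod`, applied to `h⁻¹ * h'`. -/
theorem mk_eq_mk_of_conjugateBy [IsNoetherianRing A]
    (hS : ∀ N : Matrix (Fin d) (Fin d) (ResidueField A),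
      (∀ s ∈ Set.range fun γ => (r γ : Matrix (Fin d) (Fin d) A),
        s.map (residue A) * N = N * s.map (residue A)) → ∃ c, N = scalar (Fin d) c)
    {g : G} {h h' : GL (Fin d) A} (H : ConjugateBy Γ r g h) (H' : ConjugateBy Γ r g h') :
    ProjGenLinGroup.mk h = ProjGenLinGroup.mk h' := by
  rw [ProjGenLinGroup.mk_eq_mk_iff']
  refine ⟨h⁻¹ * h', ?_, by group⟩
  obtain ⟨c, hc⟩ := exists_scalar_of_commute_mod hS ⊥ ((h⁻¹ * h' : GL (Fin d) A) : Matrix _ _ A) (by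
    rintro _ ⟨γ, rfl⟩ i j
    have e := congrArg Units.val (H.commute H' γ).eq.symm
    exact congrFun (congrFun (sub_eq_zero.mpr e) i) j)
  refine GeneralLinearGroup.mem_center_iff_val_mem_range_scalar.mpr ⟨c, ?_⟩
  ext i j
  have := hc i j
  rw [Ideal.mem_bot, Matrix.sub_apply, sub_eq_zero] at this
  exact this.symm

/-- The quotient `h⁻¹ * h'` centralizes `r`, is residually trivial and has determinant `1`, so
rigidity with `J = ⊥` applies. -/
theorem NormalizedConjugateBy.unique [IsNoetherianRing A] (hd : IsUnit (d : A))
    (hS : ∀ N : Matrix (Fin d) (Fin d) (ResidueField A),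
      (∀ s ∈ Set.range fun γ => (r γ : Matrix (Fin d) (Fin d) A),
        s.map (residue A) * N = N * s.map (residue A)) → ∃ c, N = scalar (Fin d) c)
    {g : G} {h h' : GL (Fin d) A} (H : NormalizedConjugateBy Γ r ρ₀ δ g h)
    (H' : NormalizedConjugateBy Γ r ρ₀ δ g h') : h = h' := by
  rw [← inv_mul_eq_one]
  ext i j
  have hr : GeneralLinearGroup.map (residue A) (h⁻¹ * h') = 1 := by
    rw [map_mul, map_inv, H.red, H'.red, inv_mul_cancel]
  have hdet : GeneralLinearGroup.det (h⁻¹ * h') = 1 := by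
    rw [map_mul, map_inv, H.det, H'.det, inv_mul_cancel]
  have := sub_one_mem_of_commute_mod hd hS (J := ⊥) bot_le
    (H := ((h⁻¹ * h' : GL (Fin d) A) : Matrix _ _ A)) (by
      rintro _ ⟨γ, rfl⟩ i j
      have e := congrArg Units.val (H.conj.commute H'.conj γ).eq.symm
      exact congrFun (congrFun (sub_eq_zero.mpr e) i) j)
    (by simpa only [Units.val_one] using! congrArg Units.val hr)
    (by
      have := congrArg Units.val hdet
      rw [GeneralLinearGroup.val_det_apply] at this
      rw [this]; simp) i j
  rw [Ideal.mem_bot, Matrix.sub_apply, sub_eq_zero] at this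
  exact this

/-- Scalar factors do not affect conjugation. The first one corrects the reduction; the second,
residually trivial, corrects the determinant without disturbing it. -/
theorem exists_normalizedConjugateBy [IsAdicComplete (maximalIdeal A) A] (hd : IsUnit (d : A))
    (hred : (GeneralLinearGroup.map (residue A)).comp r = ρ₀.comp Γ.subtype)
    (hcent : ∀ N : Matrix (Fin d) (Fin d) (ResidueField A),
      (∀ γ : Γ, (ρ₀ γ : Matrix (Fin d) (Fin d) (ResidueField A)) * N = N * ρ₀ γ) →
        ∃ c, N = scalar (Fin d) c)
    (hδ : (Units.map (residue A : A →* ResidueField A)).comp δ = GeneralLinearGroup.det.comp ρ₀)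
    {g : G} (hg : ∃ h, ConjugateBy Γ r g h) : ∃ h, NormalizedConjugateBy Γ r ρ₀ δ g h := by
  obtain ⟨h₀, H₀⟩ := hg
  have hredγ : ∀ γ : Γ, GeneralLinearGroup.map (residue A) (r γ) = ρ₀ γ := fun γ =>
    DFunLike.congr_fun hred γ
  have hscalar : ∀ (a : Aˣ) γ, Commute (GeneralLinearGroup.scalar (Fin d) a) (r γ) := fun a γ =>
    Units.ext (scalar_commute (a : A) (fun _ => mul_comm _ _) _).eq
  have hmapscalar : ∀ a : Aˣ, GeneralLinearGroup.map (residue A)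
      (GeneralLinearGroup.scalar (Fin d) a) =
        GeneralLinearGroup.scalar (Fin d) (Units.map (residue A : A →* ResidueField A) a) := by
    intro a
    ext i j
    rcases eq_or_ne i j with rfl | hij <;> simp [*]
  -- The discrepancy `n` between the reduction of `h₀` and `ρ₀ g` is residually scalar, since both
  -- conjugate `ρ₀` on `Γ` in the same way.
  set n := (ρ₀ g)⁻¹ * GeneralLinearGroup.map (residue A) h₀ with hn
  have hncomm : ∀ γ : Γ, ρ₀ γ * n = n * ρ₀ γ := by
    intro γ
    obtain ⟨m, e⟩ := H₀ γ
    have e₁ : ρ₀ (g * γ * g⁻¹) = GeneralLinearGroup.map (residue A) h₀ * ρ₀ γ *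
        (GeneralLinearGroup.map (residue A) h₀)⁻¹ := by
      rw [← hredγ γ, ← map_inv, ← map_mul, ← map_mul, ← e, hredγ]
    simp only [map_mul, map_inv] at e₁
    calc ρ₀ γ * n = (ρ₀ g)⁻¹ * (ρ₀ g * ρ₀ γ * (ρ₀ g)⁻¹) *
          GeneralLinearGroup.map (residue A) h₀ := by rw [hn]; group
      _ = n * ρ₀ γ := by rw [e₁, hn]; group
  obtain ⟨c, hc⟩ := hcent n fun γ => by
    simpa only [Units.val_mul] using congrArg Units.val (hncomm γ)
  have hncenter : n ∈ Subgroup.center (GL (Fin d) (ResidueField A)) :=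
    GeneralLinearGroup.mem_center_iff_val_mem_range_scalar.mpr ⟨c, hc.symm⟩
  -- Passing through the centre yields the scalar as a unit, so that its inverse can be lifted to
  -- `Aˣ`.
  rw [GeneralLinearGroup.center_eq_range_scalar] at hncenter
  obtain ⟨c, hc⟩ := hncenter
  obtain ⟨a, ha⟩ := surjective_units_map_of_local_ringHom (residue A) residue_surjective
    inferInstance c⁻¹
  set h₁ := h₀ * GeneralLinearGroup.scalar (Fin d) a with hh₁
  have hred₁ : GeneralLinearGroup.map (residue A) h₁ = ρ₀ g := by
    have e : GeneralLinearGroup.map (residue A) h₀ = ρ₀ g * n := by rw [hn]; group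
    have ha' : Units.map (residue A : A →* ResidueField A) a = c⁻¹ := ha
    rw [hh₁, map_mul, hmapscalar, ha', e, ← hc, mul_assoc, ← map_mul, mul_inv_cancel, map_one,
      mul_one]
  have hres : residue A ((δ g * (GeneralLinearGroup.det h₁)⁻¹ : Aˣ) : A) = 1 := by
    have e₁ : Units.map (residue A : A →* ResidueField A) (δ g) =
        GeneralLinearGroup.det (ρ₀ g) := DFunLike.congr_fun hδ g
    have e₂ : Units.map (residue A : A →* ResidueField A) (GeneralLinearGroup.det h₁) =
        GeneralLinearGroup.det (ρ₀ g) := by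
      rw [← hred₁]
      ext
      simp [RingHom.map_det]
    have e₃ : Units.map (residue A : A →* ResidueField A)
        (δ g * (GeneralLinearGroup.det h₁)⁻¹) = 1 := by
      rw [map_mul, map_inv, e₁, e₂, mul_inv_cancel]
    exact congrArg Units.val e₃
  -- The scalar matrix `b` multiplies the determinant by `b ^ d`, hence the `d`-th root.
  obtain ⟨b, hb, hb₁⟩ := exists_pow_eq_of_residue_eq_one hd hres
  have hbu : IsUnit b := by
    rw [← isUnit_map_iff (residue A), hb₁]
    exact isUnit_one
  obtain ⟨b, rfl⟩ := hbu
  refine ⟨h₁ * GeneralLinearGroup.scalar (Fin d) b,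
    (H₀.mul_of_commute (hscalar a)).mul_of_commute (hscalar b), ?_, ?_⟩
  · have : Units.map (residue A : A →* ResidueField A) b = 1 := Units.ext hb₁
    rw [map_mul, hmapscalar, this, map_one, mul_one, hred₁]
  · have e : GeneralLinearGroup.det (GeneralLinearGroup.scalar (Fin d) b) = b ^ d := by
      ext
      simp
    have hb' : b ^ d = δ g * (GeneralLinearGroup.det h₁)⁻¹ :=
      Units.ext ((Units.val_pow_eq_pow_val b d).trans hb)
    rw [map_mul, e, hb', mul_comm, mul_assoc, inv_mul_cancel, mul_one]

/-- **Extension of representations from a subgroup of a profinite group.** Let `r` be a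
representation of a subgroup `Γ` over a complete Noetherian local ring with scalar residual
centralizer, isomorphic to all of its conjugates. If `d` is invertible, then `r` extends to a continuous
representation of `G` with given compatible reduction and determinant. -/
theorem exists_extension [TopologicalSpace G] [IsTopologicalGroup G] [CompactSpace G]
    [TotallyDisconnectedSpace G] [IsNoetherianRing A] [IsAdicComplete (maximalIdeal A) A]
    [TopologicalSpace A] (hA : IsAdic (maximalIdeal A)) (hd : IsUnit (d : A))
    (hr : Continuous r)
    (hred : (GeneralLinearGroup.map (residue A)).comp r = ρ₀.comp Γ.subtype)
    (hcent : ∀ N : Matrix (Fin d) (Fin d) (ResidueField A),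
      (∀ γ : Γ, (ρ₀ γ : Matrix (Fin d) (Fin d) (ResidueField A)) * N = N * ρ₀ γ) →
        ∃ c, N = scalar (Fin d) c)
    (hδ : (Units.map (residue A : A →* ResidueField A)).comp δ = GeneralLinearGroup.det.comp ρ₀)
    (hdet : GeneralLinearGroup.det.comp r = δ.comp Γ.subtype)
    (hρ₀ : ∀ᶠ u in nhds (1 : G), ρ₀ u = 1)
    (hδc : ∀ n : ℕ, ∀ᶠ u in nhds (1 : G), (δ u : A) - 1 ∈ maximalIdeal A ^ n)
    (hconj : ∀ g, ∃ h, ConjugateBy Γ r g h) :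
    ∃ ρ : G →* GL (Fin d) A, Continuous ρ ∧ (∀ g, NormalizedConjugateBy Γ r ρ₀ δ g (ρ g)) ∧
      ρ.comp Γ.subtype = r := by
  have hS := centralizer_residue hred hcent
  choose φ hφ using fun g => exists_normalizedConjugateBy hd hred hcent hδ (hconj g)
  let ρ : G →* GL (Fin d) A := MonoidHom.mk' φ fun g g' =>
    (hφ (g * g')).unique hd hS ((hφ g).mul (hφ g'))
  have hρ : ∀ g, NormalizedConjugateBy Γ r ρ₀ δ g (ρ g) := hφ
  refine ⟨ρ, ?_, hρ, ?_⟩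
  · refine continuous_of_eventually_sub_one_mem hA ρ fun n => ?_
    -- Rigidity needs `J` inside the maximal ideal, which excludes exponent `0`.
    rcases Nat.eq_zero_or_pos n with rfl | hn
    · simp
    have hrn : ∀ᶠ γ in nhds (1 : Γ), ∀ i j,
        ((r γ : Matrix (Fin d) (Fin d) A) - 1) i j ∈ maximalIdeal A ^ n := by
      subst hA
      let _ := (maximalIdeal A).adicTopology
      simp only [Filter.eventually_all]
      intro i j
      have hc : Continuous fun γ => (r γ : Matrix (Fin d) (Fin d) A) i j :=
        (Units.continuous_val.comp hr).matrix_elem i j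
      have := (((maximalIdeal A).hasBasis_nhds_adic _).tendsto_right_iff).mp (hc.tendsto 1) n trivial
      filter_upwards [this] with γ hγ
      obtain ⟨t, ht, hγ⟩ := hγ
      rw [Matrix.sub_apply, ← hγ]
      simpa using ht
    obtain ⟨W, hW, hWr⟩ := Filter.eventually_iff_exists_mem.mp
      hrn
    rw [nhds_subtype] at hW
    obtain ⟨V, hV, hVW⟩ := Filter.mem_comap.mp hW
    obtain ⟨V', hV'V, hV'o, h1V'⟩ := mem_nhds_iff.mp hV
    -- Normality of `U` puts the commutators of `u ∈ U` with all of `Γ` in `U`, uniformly in `γ`.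
    obtain ⟨U, hU⟩ := ProfiniteGrp.exist_openNormalSubgroup_sub_open_nhds_of_one hV'o h1V'
    filter_upwards [hρ₀, hδc n, U.isOpen'.mem_nhds U.one_mem'] with u hu₀ huδ huU
    refine sub_one_mem_of_commute_mod hd hS (Ideal.pow_le_self hn.ne') ?_ ?_ ?_
    · rintro _ ⟨γ, rfl⟩ i j
      obtain ⟨m, e⟩ := (hρ u).conj γ
      let τ : Γ := ⟨u * γ * u⁻¹, m⟩ * γ⁻¹
      have hτU : (τ : G) ∈ (U : Set G) := by
        change u * γ * u⁻¹ * (γ : G)⁻¹ ∈ U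
        have h1 : (γ : G) * u⁻¹ * (γ : G)⁻¹ ∈ U :=
          U.isNormal'.conj_mem _ (inv_mem (show u ∈ U from huU)) _
        have h2 := mul_mem (show u ∈ U from huU) h1
        convert h2 using 1
        group
      have hτ := hWr τ (hVW (hV'V (hU hτU)))
      have e' : ρ u * r γ = r τ * (r γ * ρ u) := by
        rw [map_mul, map_inv, e]; group
      -- The failure of `ρ u` to commute with `r γ` is a multiple of `r τ - 1`, where `τ` is their
      -- commutator.
      have e'' : (r γ : Matrix (Fin d) (Fin d) A) * ρ u - ρ u * r γ =
          -(((r τ : Matrix (Fin d) (Fin d) A) - 1) * (r γ * ρ u)) := by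
        rw [sub_mul, one_mul, ← Units.val_mul, ← Units.val_mul, ← Units.val_mul, ← e', neg_sub]
      rw [e'', Matrix.neg_apply, neg_mem_iff, Matrix.mul_apply]
      exact Ideal.sum_mem _ fun k _ => Ideal.mul_mem_right _ _ (hτ i k)
    · exact congrArg Units.val ((hρ u).red.trans hu₀)
    · rw [← GeneralLinearGroup.val_det_apply, (hρ u).det]
      exact huδ
  · ext1 γ
    exact (hρ γ).unique hd hS ⟨conjugateBy_coe γ, DFunLike.congr_fun hred γ,
      DFunLike.congr_fun hdet γ⟩

end Lift

end GaloisLift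

/-! ### Invertibility of `d` and comparison of `O` with `A` -/

namespace EllAdic

/-- An integer prime to `ℓ` is a unit in every `ℤ_ℓ`-algebra. -/
theorem isUnit_natCast_of_not_dvd {ℓ d : ℕ} [Fact ℓ.Prime] (hd : ¬ ℓ ∣ d) (A : Type*)
    [CommRing A] [Algebra ℤ_[ℓ] A] : IsUnit (d : A) := by
  have h : IsUnit (d : ℤ_[ℓ]) := by
    rw [PadicInt.isUnit_iff]
    refine le_antisymm (PadicInt.norm_le_one _) (not_lt.mp fun hlt => hd ?_)
    exact_mod_cast (PadicInt.norm_int_lt_one_iff_dvd (d : ℤ)).mp (by exact_mod_cast hlt)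
  simpa using h.map (algebraMap ℤ_[ℓ] A)

end EllAdic

namespace GaloisLift

open Matrix

section Algebra

variable {O A : Type*} [CommRing O] [IsLocalRing O] [CommRing A] [IsLocalRing A] [Algebra O A]

theorem residue_algebraMap (α : ResidueField A ≃ₐ[O] ResidueField O) (a : O) :
    residue A (algebraMap O A a) = α.symm (residue O a) :=
  (α.symm.commutes a).symm

/-- The `O`-linearity of `α` forces the structure map to carry `𝔪_O` into `𝔪_A`. This transfers the
`𝔪_O`-adic continuity of `ε` to its image in `Aˣ`. -/
theorem algebraMap_mem_maximalIdeal_pow (α : ResidueField A ≃ₐ[O] ResidueField O) {n : ℕ} {a : O}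
    (ha : a ∈ maximalIdeal O ^ n) : algebraMap O A a ∈ maximalIdeal A ^ n := by
  have hle : (maximalIdeal O).map (algebraMap O A) ≤ maximalIdeal A := by
    rw [Ideal.map_le_iff_le_comap]
    intro b hb
    rw [Ideal.mem_comap, ← residue_eq_zero_iff, residue_algebraMap α,
      (residue_eq_zero_iff b).mpr hb, map_zero]
  have h := Ideal.mem_map_of_mem (algebraMap O A) ha
  rw [Ideal.map_pow] at h
  exact Ideal.pow_right_mono hle n h

end Algebra

end GaloisLift

/-! ### The theorem for étale fundamental groups -/

theorem proposition4p2
    (ℓ d : ℕ) [Fact ℓ.Prime] (hℓ : ℓ ≠ 2) (hd : ¬ ℓ ∣ d)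
    -- the curve `X` over `k`, and its geometric base point
    {k kbar : Type u} [Field k] (hk : (ℓ : k) ≠ 0) [Field kbar] [Algebra k kbar]
    [IsAlgClosed kbar] [Algebra.IsAlgebraic k kbar]
    {X : Scheme.{u}} (f : X ⟶ Spec (.of k))
    [SmoothOfRelativeDimension 1 f] [IsProper f] [GeometricallyConnected f]
    (x : Spec (.of kbar) ⟶ X)
    (hx : x ≫ f = Spec.map (CommRingCat.ofHom (algebraMap k kbar)))
    -- the ring of integers `O` of a finite extension `E` of `ℚ_ℓ`; its residue field is discrete
    {E : Type w} [Field E] [Algebra ℚ_[ℓ] E] [FiniteDimensional ℚ_[ℓ] E]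
    [Algebra ℤ_[ℓ] E] [IsScalarTower ℤ_[ℓ] ℚ_[ℓ] E]
    [TopologicalSpace (integralClosure ℤ_[ℓ] E)]
    (hO : IsAdic (maximalIdeal (integralClosure ℤ_[ℓ] E)))
    [TopologicalSpace (ResidueField (integralClosure ℤ_[ℓ] E))]
    [DiscreteTopology (ResidueField (integralClosure ℤ_[ℓ] E))]
    -- the residual representation and the determinant character of `π₁(X)`
    (ρ₀ : EtalePi.PiOne X x →* GL (Fin d) (ResidueField (integralClosure ℤ_[ℓ] E)))
    (hρ₀ : Continuous ρ₀)
    (ε : EtalePi.PiOne X x →* (integralClosure ℤ_[ℓ] E)ˣ) (hε : Continuous ε)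
    (hε₀ : (Units.map (residue (integralClosure ℤ_[ℓ] E) : _ →* _)).comp ε =
      Matrix.GeneralLinearGroup.det.comp ρ₀)
    (hirr : GaloisLift.IsAbsolutelyIrreducible
      (ρ₀.comp (EtalePi.geomPiOne f x hx).subtype))
    -- a complete Noetherian local `O`-algebra `A` with residue field identified with that of `O`
    {A : Type v} [CommRing A] [IsLocalRing A] [IsNoetherianRing A]
    [IsAdicComplete (maximalIdeal A) A] [Algebra (integralClosure ℤ_[ℓ] E) A]
    (α : ResidueField A ≃ₐ[integralClosure ℤ_[ℓ] E] ResidueField (integralClosure ℤ_[ℓ] E))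
    [TopologicalSpace A] (hA : IsAdic (maximalIdeal A))
    -- the lift `ρbar` over `A` of the restriction of `ρ₀` to `π₁(X̄)`
    (ρbar : EtalePi.geomPiOne f x hx →* GL (Fin d) A) (hρbar : Continuous ρbar)
    (hlift : (GaloisLift.reduction d α).comp ρbar =
      ρ₀.comp (EtalePi.geomPiOne f x hx).subtype)
    (hdet : Matrix.GeneralLinearGroup.det.comp ρbar =
      (Units.map (algebraMap (integralClosure ℤ_[ℓ] E) A : _ →* _)).comp
        (ε.comp (EtalePi.geomPiOne f x hx).subtype))
    (hconj : ∀ g : EtalePi.PiOne X x, ∃ h : GL (Fin d) A,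
      GaloisLift.ConjugateBy (EtalePi.geomPiOne f x hx) ρbar g h) :
    -- the projective representation given by the conjugating matrices, and its lift
    ∃ ρPGL : EtalePi.PiOne X x →* PGL(d, A),
      (∀ (g : EtalePi.PiOne X x) (h : GL (Fin d) A),
        GaloisLift.ConjugateBy (EtalePi.geomPiOne f x hx) ρbar g h →
          ρPGL g = Matrix.ProjGenLinGroup.mk h) ∧
      ρPGL.comp (EtalePi.geomPiOne f x hx).subtype = Matrix.ProjGenLinGroup.mk.comp ρbar ∧
      ∃ ρ : EtalePi.PiOne X x →* GL (Fin d) A,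
        Continuous ρ ∧
        Matrix.ProjGenLinGroup.mk.comp ρ = ρPGL ∧
        Matrix.GeneralLinearGroup.det.comp ρ =
          (Units.map (algebraMap (integralClosure ℤ_[ℓ] E) A : _ →* _)).comp ε ∧
        ρ.comp (EtalePi.geomPiOne f x hx).subtype = ρbar ∧
        (GaloisLift.reduction d α).comp ρ = ρ₀ := by
  let O := integralClosure ℤ_[ℓ] E
  -- The general extension theorem takes its residual representation over the residue field of `A`,
  -- so `ρ₀` is transported there by `α⁻¹`.
  let ψ : GL (Fin d) (ResidueField O) →* GL (Fin d) (ResidueField A) :=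
    Matrix.GeneralLinearGroup.map ((α.symm : ResidueField O →+* ResidueField A))
  have hψ : ∀ m, GaloisLift.reduction d α m =
      Matrix.GeneralLinearGroup.map (α : ResidueField A →+* ResidueField O)
        (Matrix.GeneralLinearGroup.map (residue A) m) := fun _ => rfl
  have hαψ : ∀ m, Matrix.GeneralLinearGroup.map (α : ResidueField A →+* ResidueField O)
      (ψ m) = m := fun m => by
    ext i j
    exact α.apply_symm_apply _
  have hψα : ∀ m, ψ (Matrix.GeneralLinearGroup.map (α : ResidueField A →+* ResidueField O) m) =
      m := fun m => by
    ext i j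
    exact α.symm_apply_apply _
  let δ : EtalePi.PiOne X x →* Aˣ := (Units.map (algebraMap O A : O →* A)).comp ε
  have hred : (Matrix.GeneralLinearGroup.map (residue A)).comp ρbar =
      (ψ.comp ρ₀).comp (EtalePi.geomPiOne f x hx).subtype := by
    ext1 γ
    have h := congrArg ψ (DFunLike.congr_fun hlift γ)
    rw [MonoidHom.comp_apply, hψ, hψα] at h
    exact h
  have hcent : ∀ N : Matrix (Fin d) (Fin d) (ResidueField A),
      (∀ γ : EtalePi.geomPiOne f x hx,
        ((ψ.comp ρ₀) γ : Matrix (Fin d) (Fin d) (ResidueField A)) * N = N * (ψ.comp ρ₀) γ) →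
        ∃ c, N = Matrix.scalar (Fin d) c := by
    intro N hN
    obtain ⟨c, hc⟩ := hirr.exists_eq_scalar (N.map α) fun γ => by
      have h := congrArg (fun M : Matrix (Fin d) (Fin d) (ResidueField A) => M.map α) (hN γ)
      have e : ((ψ.comp ρ₀) γ : Matrix (Fin d) (Fin d) (ResidueField A)).map α =
          (ρ₀ γ : Matrix (Fin d) (Fin d) (ResidueField O)) := congrArg Units.val (hαψ (ρ₀ γ))
      simp only [Matrix.map_mul, e] at h
      exact h
    refine ⟨α.symm c, ?_⟩
    ext i j
    apply α.injective
    refine (congrFun (congrFun hc i) j).trans ?_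
    rcases eq_or_ne i j with rfl | hij <;> simp [*]
  have hδ : (Units.map (residue A : A →* ResidueField A)).comp δ =
      Matrix.GeneralLinearGroup.det.comp (ψ.comp ρ₀) := by
    ext g
    have h := congrArg (fun z => α.symm (Units.val z)) (DFunLike.congr_fun hε₀ g)
    refine (GaloisLift.residue_algebraMap α _).trans (h.trans ?_)
    exact RingHom.map_det (α.symm : ResidueField O →+* ResidueField A) _
  have hρ₀' : ∀ᶠ u in nhds (1 : EtalePi.PiOne X x), (ψ.comp ρ₀) u = 1 := by
    have hc : Continuous fun u => (ρ₀ u : Matrix (Fin d) (Fin d) (ResidueField O)) :=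
      Units.continuous_val.comp hρ₀
    -- The residue field is discrete, so `ρ₀` has open kernel.
    have ho : IsOpen ((fun u => (ρ₀ u : Matrix (Fin d) (Fin d) (ResidueField O))) ⁻¹' {1}) := by
      have : DiscreteTopology (Matrix (Fin d) (Fin d) (ResidueField O)) :=
        inferInstanceAs (DiscreteTopology (Fin d → Fin d → ResidueField O))
      exact (isOpen_discrete _).preimage hc
    filter_upwards [ho.mem_nhds (by simp)] with u hu
    have : ρ₀ u = 1 := Units.ext hu
    rw [MonoidHom.comp_apply, this, map_one]
  have hδc : ∀ n : ℕ, ∀ᶠ u in nhds (1 : EtalePi.PiOne X x),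
      (δ u : A) - 1 ∈ maximalIdeal A ^ n := by
    intro n
    have hc : Filter.Tendsto (fun u => (ε u : O)) (nhds 1) (nhds 1) := by
      simpa [Function.comp_def] using (Units.continuous_val.comp hε).tendsto 1
    rw [hO] at hc
    have := (((maximalIdeal O).hasBasis_nhds_adic 1).tendsto_right_iff).mp hc n trivial
    filter_upwards [this] with u hu
    obtain ⟨t, ht, hu⟩ := hu
    have e : (δ u : A) - 1 = algebraMap O A t := by
      change algebraMap O A (ε u : O) - 1 = _
      rw [← hu]
      simp
    rw [e]
    exact GaloisLift.algebraMap_mem_maximalIdeal_pow α ht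
  have hdO : IsUnit (d : O) := EllAdic.isUnit_natCast_of_not_dvd (ℓ := ℓ) hd O
  have hdA : IsUnit (d : A) := by simpa using hdO.map (algebraMap O A)
  obtain ⟨ρ, hρc, hρ, hρr⟩ := GaloisLift.exists_extension hA hdA hρbar hred hcent hδ hdet
    hρ₀' hδc hconj
  refine ⟨Matrix.ProjGenLinGroup.mk.comp ρ, fun g h hh => ?_, ?_, ρ, hρc, rfl, ?_, hρr, ?_⟩
  · exact GaloisLift.mk_eq_mk_of_conjugateBy (GaloisLift.centralizer_residue hred hcent)
      (hρ g).conj hh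
  · rw [MonoidHom.comp_assoc, hρr]
  · ext1 g
    exact (hρ g).det
  · ext1 g
    rw [MonoidHom.comp_apply, hψ, (hρ g).red]
    exact hαψ _
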